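/- Let $(A,\mathfrak m)$ be a Cohen–Macaulay local ring of (Krull) dimension $d \ge 1$. Assume that $A$ is essentially of finite type over a field $K$, and that the $\mathfrak m$-adic completion $\widehat{A}$ of $A$ is a domain. Let $A^h$ be the henselization of $A$, that is, the direct limit of all pointed étale neighborhoods of $A$, where a pointed étale neighborhood of $A$ is a flat local homomorphism $(A,\mathfrak m)\to(B,\mathfrak n)$, essentially of finite type, with $\mathfrak m B=\mathfrak n$, that induces an isomorphism $A/\mathfrak m\to B/\mathfrak n$ of residue fields. Then $A^h$ (with the $K$-algebra structure $K\to A\to A^h$) is not essentially of finite type over $K$. -/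

import Mathlib

open IsLocalRing

universe u

/-- The depth of a local ring: the supremum of the lengths of the regular sequences on `A`
contained in the maximal ideal. -/
noncomputable def localDepth (A : Type*) [CommRing A] [IsLocalRing A] : ℕ∞ :=
  ⨆ rs : {rs : List A // (∀ r ∈ rs, r ∈ maximalIdeal A) ∧ RingTheory.Sequence.IsRegular A rs},
    (rs.1.length : ℕ∞)

/-- A Cohen–Macaulay local ring: a Noetherian local ring whose depth equals its Krull dimension. -/
structure IsCohenMacaulayLocalRing (A : Type*) [CommRing A] [IsLocalRing A] : Prop where
  isNoetherianRing : IsNoetherianRing A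
  depth_eq : (localDepth A : WithBot ℕ∞) = ringKrullDim A

/-- `A → B` is an unramified extension of local rings: a local homomorphism, essentially of finite
type, with `𝔪_A B = 𝔪_B` and with finite separable extension of residue fields. -/
structure IsUnramifiedLocalExtension (A B : Type*) [CommRing A] [IsLocalRing A]
    [CommRing B] [IsLocalRing B] [Algebra A B] : Prop where
  isLocalHom : IsLocalHom (algebraMap A B)
  essFiniteType : Algebra.EssFiniteType A B
  map_maximalIdeal : (maximalIdeal A).map (algebraMap A B) = maximalIdeal B
  finite_residueField : Module.Finite (ResidueField A) (ResidueField B)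
  isSeparable_residueField : Algebra.IsSeparable (ResidueField A) (ResidueField B)

/-- `A → B` is an étale extension of local rings: unramified and flat. -/
structure IsEtaleLocalExtension (A B : Type*) [CommRing A] [IsLocalRing A]
    [CommRing B] [IsLocalRing B] [Algebra A B] : Prop
    extends IsUnramifiedLocalExtension A B where
  flat : Module.Flat A B

/-- `B` is a pointed étale neighborhood of `A`: an étale extension of local rings that induces an
isomorphism of residue fields. -/
structure IsPointedEtaleNhd (A B : Type*) [CommRing A] [IsLocalRing A]
    [CommRing B] [IsLocalRing B] [Algebra A B] : Prop
    extends IsEtaleLocalExtension A B where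
  bijective_residueField :
    Function.Bijective (algebraMap (ResidueField A) (ResidueField B))

/-- Any `A`-algebra homomorphism between pointed étale neighborhoods of `A` is local. -/
theorem IsPointedEtaleNhd.isLocalHom_of_algHom {A B C : Type*} [CommRing A] [IsLocalRing A]
    [CommRing B] [IsLocalRing B] [Algebra A B] [CommRing C] [IsLocalRing C] [Algebra A C]
    (hB : IsPointedEtaleNhd A B) (hC : IsPointedEtaleNhd A C) (f : B →ₐ[A] C) :
    IsLocalHom (f : B →+* C) := by
  refine ((local_hom_TFAE (f : B →+* C)).out 0 2).mpr ?_
  rw [← hB.map_maximalIdeal, Ideal.map_map, ← hC.map_maximalIdeal]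
  exact le_of_eq (congrArg (fun g => (maximalIdeal A).map g) f.comp_algebraMap)

/-- Being a pointed étale neighborhood is invariant under isomorphism. -/
theorem IsPointedEtaleNhd.of_algEquiv {A B C : Type*} [CommRing A] [IsLocalRing A]
    [CommRing B] [IsLocalRing B] [Algebra A B] [CommRing C] [IsLocalRing C] [Algebra A C]
    (hB : IsPointedEtaleNhd A B) (e : B ≃ₐ[A] C) : IsPointedEtaleNhd A C := by
  have hBl := hB.isLocalHom
  have hess := hB.essFiniteType
  have hfl := hB.flat
  have hfin := hB.finite_residueField
  have hsep := hB.isSeparable_residueField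
  have hcomp : (e : B →+* C).comp (algebraMap A B) = algebraMap A C :=
    (e : B →ₐ[A] C).comp_algebraMap
  have hel : IsLocalHom (e : B →+* C) := ⟨fun a ha => by
    simpa using ha.map (e.symm : C →+* B)⟩
  have hCl : IsLocalHom (algebraMap A C) := by
    rw [← hcomp]; infer_instance
  let r : ResidueField B ≃+* ResidueField C := ResidueField.mapEquiv e.toRingEquiv
  have hr : ∀ x, r (algebraMap (ResidueField A) (ResidueField B) x) =
      algebraMap (ResidueField A) (ResidueField C) x := by
    intro x
    obtain ⟨a, rfl⟩ := residue_surjective x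
    change residue C (e (algebraMap A B a)) = residue C (algebraMap A C a)
    rw [e.commutes]
  let r' : ResidueField B ≃ₐ[ResidueField A] ResidueField C := AlgEquiv.ofRingEquiv (f := r) hr
  exact
    { isLocalHom := hCl
      essFiniteType := (Algebra.EssFiniteType.iff_of_algEquiv e).mp hess
      map_maximalIdeal := by
        rw [← hcomp, ← Ideal.map_map, hB.map_maximalIdeal]
        refine le_antisymm (((local_hom_TFAE (e : B →+* C)).out 0 2).mp hel) ?_
        intro c hc
        have : c = (e : B →+* C) (e.symm c) := by simp
        rw [this]
        refine Ideal.mem_map_of_mem _ ?_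
        rw [mem_maximalIdeal, mem_nonunits_iff] at hc ⊢
        intro h
        apply hc
        rw [this]
        exact h.map (e : B →+* C)
      finite_residueField := Module.Finite.equiv r'.toLinearEquiv
      isSeparable_residueField := AlgEquiv.Algebra.isSeparable r'
      flat := Module.Flat.of_linearEquiv e.symm.toLinearEquiv
      bijective_residueField := by
        have : (algebraMap (ResidueField A) (ResidueField C) : _ → _) =
            r ∘ algebraMap (ResidueField A) (ResidueField B) := by
          funext x; exact (hr x).symm
        rw [this]
        exact r.bijective.comp hB.bijective_residueField }

/-- A small model of the collection of pointed étale neighborhoods of `A`: a pointed étale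
neighborhood is presented as the localization of `A[X₁, …, Xₙ] / I` at a prime ideal. Every pointed
étale neighborhood is isomorphic to one of these (`PointedEtaleNhd.exists_algEquiv`). -/
structure PointedEtaleNhd (A : Type u) [CommRing A] [IsLocalRing A] : Type u where
  n : ℕ
  I : Ideal (MvPolynomial (Fin n) A)
  q : PrimeSpectrum (MvPolynomial (Fin n) A ⧸ I)
  isPointedEtaleNhd : IsPointedEtaleNhd A (Localization.AtPrime q.asIdeal)

namespace PointedEtaleNhd

/-- The local ring of a (presented) pointed étale neighborhood, as an `A`-algebra. -/
noncomputable def toCommAlgCat {A : Type u} [CommRing A] [IsLocalRing A]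
    (B : PointedEtaleNhd A) : CommAlgCat.{u} A :=
  CommAlgCat.of A (Localization.AtPrime B.q.asIdeal)

/-- Pointed étale neighborhoods of `A` form a category, with the (automatically local) `A`-algebra
homomorphisms of the underlying local rings as morphisms. -/
noncomputable instance (A : Type u) [CommRing A] [IsLocalRing A] :
    CategoryTheory.Category.{u} (PointedEtaleNhd A) :=
  inferInstanceAs (CategoryTheory.Category.{u}
    (CategoryTheory.InducedCategory (CommAlgCat.{u} A) toCommAlgCat))

/-- The system of `A`-algebras given by all pointed étale neighborhoods of `A`. -/
noncomputable def diagram (A : Type u) [CommRing A] [IsLocalRing A] :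
    CategoryTheory.Functor (PointedEtaleNhd A) (CommAlgCat.{u} A) :=
  CategoryTheory.inducedFunctor toCommAlgCat

/-- Every pointed étale neighborhood of `A` is isomorphic to a presented one. -/
theorem exists_algEquiv {A : Type u} [CommRing A] [IsLocalRing A] {B : Type*} [CommRing B]
    [IsLocalRing B] [Algebra A B] (hB : IsPointedEtaleNhd A B) :
    ∃ N : PointedEtaleNhd A, Nonempty (Localization.AtPrime N.q.asIdeal ≃ₐ[A] B) := by
  have hess := hB.essFiniteType
  let S := Algebra.EssFiniteType.subalgebra A B
  obtain ⟨n, φ, hφ⟩ := Algebra.FiniteType.iff_quotient_mvPolynomial''.mp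
    (inferInstance : Algebra.FiniteType A S)
  let I := RingHom.ker φ
  let e := Ideal.quotientKerAlgEquivOfSurjective hφ
  let g : (MvPolynomial (Fin n) A ⧸ I) →ₐ[A] B := S.val.comp (e : _ →ₐ[A] S)
  let q : PrimeSpectrum (MvPolynomial (Fin n) A ⧸ I) :=
    ⟨(maximalIdeal B).comap (g : _ →+* B), inferInstance⟩
  let _ : Algebra (MvPolynomial (Fin n) A ⧸ I) B := (g : _ →+* B).toAlgebra
  have hg : ∀ x, algebraMap (MvPolynomial (Fin n) A ⧸ I) B x = (e x : B) := fun x => rfl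
  have : IsScalarTower A (MvPolynomial (Fin n) A ⧸ I) B :=
    IsScalarTower.of_algebraMap_eq fun a => (g.commutes a).symm
  have hq : ∀ x, x ∈ q.asIdeal.primeCompl ↔ IsUnit (e x : B) := by
    intro x
    change ¬ ((e x : B) ∈ maximalIdeal B) ↔ _
    rw [mem_maximalIdeal, mem_nonunits_iff, not_not]
  have : IsLocalization.AtPrime B q.asIdeal := by
    have hloc := Algebra.EssFiniteType.isLocalization A B
    refine ⟨fun y => by rw [hg]; exact (hq _).mp y.2, fun b => ?_, fun {x y} h => ?_⟩
    · obtain ⟨⟨s, t⟩, h⟩ := IsLocalization.surj (Algebra.EssFiniteType.submonoid A B) b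
      refine ⟨⟨e.symm s, ⟨e.symm t.1, (hq _).mpr ?_⟩⟩, ?_⟩
      · rw [e.apply_symm_apply]; exact t.2
      · rw [hg, hg]; simpa using h
    · refine ⟨1, ?_⟩
      rw [hg, hg] at h
      rw [e.injective (Subtype.ext h)]
  let f : Localization.AtPrime q.asIdeal ≃ₐ[A] B :=
    (IsLocalization.algEquiv q.asIdeal.primeCompl
      (Localization.AtPrime q.asIdeal) B).restrictScalars A
  exact ⟨⟨n, I, q, hB.of_algEquiv f.symm⟩, ⟨f⟩⟩

end PointedEtaleNhd

/-- The henselization of a local ring `A`: the direct limit, in `A`-algebras, of all pointed étale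
neighborhoods of `A`. -/
noncomputable def Henselization (A : Type u) [CommRing A] [IsLocalRing A] : Type u :=
  (CategoryTheory.Limits.colimit (PointedEtaleNhd.diagram A) : CommAlgCat.{u} A)

noncomputable instance (A : Type u) [CommRing A] [IsLocalRing A] : CommRing (Henselization A) :=
  inferInstanceAs (CommRing
    (CategoryTheory.Limits.colimit (PointedEtaleNhd.diagram A) : CommAlgCat.{u} A))

noncomputable instance (A : Type u) [CommRing A] [IsLocalRing A] : Algebra A (Henselization A) :=
  inferInstanceAs (Algebra A
    (CategoryTheory.Limits.colimit (PointedEtaleNhd.diagram A) : CommAlgCat.{u} A))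

/-! The obstruction is the existence of roots. As `dim A ≥ 1`, the maximal ideal contains some `t`
transcendental over `K`. For every `N` invertible in `A`, `1 + t` has an `N`-th root in the
henselization (`exists_isPointedEtaleNhd_pow_eq`), and such `N` are unbounded. Since `A` embeds in
its henselization (`Henselization.algebraMap_injective`), `1 + t` is still transcendental there. In
a `K`-algebra essentially of finite type this cannot happen
(`Transcendental.exists_forall_pow_eq_le_of_essFiniteType`): modulo a suitable prime the element
lies in a finitely generated field `L`, is still transcendental, and `L` is finite over some `F(u)`
with `u` the element. Taking norms to `F(u)` and comparing degrees in `u` shows that `N` divides `[L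
: F(u)]`. -/

/-! ### Roots of transcendental elements in finitely generated fields. -/

open IntermediateField in
/-- An element `u` of a field finite over `F(u)`, with `u` transcendental over `F`, has `N`-th roots
only for bounded `N`. -/
theorem Transcendental.le_finrank_of_pow_eq {F L : Type*} [Field F] [Field L] [Algebra F L] {u : L}
    (hu : Transcendental F u) [FiniteDimensional F⟮u⟯ L] {N : ℕ} {w : L} (hw : w ^ N = u) :
    N ≤ Module.finrank F⟮u⟯ L := by
  set M := Module.finrank F⟮u⟯ L
  have hM : 0 < M := Module.finrank_pos
  let e := (RatFunc.algEquivOfTranscendental u hu).symm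
  have hw0 : w ≠ 0 := by
    rintro rfl
    rcases eq_or_ne N 0 with rfl | hN
    · refine hu ?_
      rw [← hw, pow_zero]
      exact isAlgebraic_one
    · rw [zero_pow hN] at hw
      exact hu (hw ▸ isAlgebraic_zero)
  -- The norm of `u` is `u ^ M`; its degree in `u` is `M`, while that of an `N`-th power is a
  -- multiple of `N`.
  have h1 : Algebra.norm F⟮u⟯ w ^ N = AdjoinSimple.gen F u ^ M := by
    rw [← map_pow, hw, ← Algebra.norm_algebraMap, AdjoinSimple.algebraMap_gen]
  have hdeg : ∀ (x : RatFunc F) (_ : x ≠ 0) (n : ℕ), (x ^ n).intDegree = n * x.intDegree := by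
    intro x hx n
    induction n with
    | zero => simp
    | succ n ih =>
      rw [pow_succ, RatFunc.intDegree_mul (pow_ne_zero _ hx) hx, ih]
      push_cast
      ring
  have h2 : (N : ℤ) * (e (Algebra.norm F⟮u⟯ w)).intDegree = M := by
    have h := congrArg (fun x => (e x).intDegree) h1
    simp only [map_pow] at h
    rw [hdeg _ (by simpa [Algebra.norm_eq_zero_iff] using hw0),
      RatFunc.algEquivOfTranscendental_symm_gen, hdeg _ RatFunc.X_ne_zero,
      RatFunc.intDegree_X, mul_one] at h
    exact h
  exact Nat.le_of_dvd hM (Int.natCast_dvd_natCast.mp ⟨_, h2.symm⟩)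

open IntermediateField algebraAdjoinAdjoin in
/-- In a finitely generated field extension `L / K`, an element transcendental over `K` has `N`-th
roots only for bounded `N`. -/
theorem Transcendental.exists_forall_pow_eq_le {K L : Type*} [Field K] [Field L] [Algebra K L]
    [Algebra.EssFiniteType K L] {u : L} (hu : Transcendental K u) :
    ∃ M : ℕ, ∀ (N : ℕ) (w : L), w ^ N = u → N ≤ M := by
  have hsing : AlgebraicIndepOn K id ({u} : Set L) := by
    simpa [AlgebraicIndepOn, algebraicIndependent_unique_type_iff] using hu
  obtain ⟨b, hub, hb⟩ := exists_isTranscendenceBasis_superset hsing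
  have hub : u ∈ b := hub rfl
  -- All of the transcendence basis except `u` goes into the base field, so `u` stays transcendental
  -- over `F` and `L` is algebraic over `F(u)`, hence finite.
  let F := adjoin K (b \ {u})
  have huF : Transcendental F u := by
    have h := hb.1.transcendental_adjoin (i := ⟨u, hub⟩) (s := {⟨u, hub⟩}ᶜ) (by simp)
    have hs : ((↑) : b → L) '' {⟨u, hub⟩}ᶜ = b \ {u} := by
      ext x; simp [and_comm]
    rw [hs] at h
    exact fun h' => h ((IsFractionRing.isAlgebraic_iff (Algebra.adjoin K (b \ {u})) F L).mpr h')
  have hle : adjoin K b ≤ F⟮u⟯.restrictScalars K := by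
    rw [adjoin_le_iff]
    intro x hx
    by_cases hxu : x = u
    · rw [hxu]; exact mem_adjoin_simple_self F u
    · exact F⟮u⟯.algebraMap_mem ⟨x, subset_adjoin K _ ⟨hx, hxu⟩⟩
  have halg : Algebra.IsAlgebraic F⟮u⟯ L := by
    have h : Algebra.IsAlgebraic (adjoin K b) L := by
      have h := hb.isAlgebraic_field
      rwa [Subtype.range_coe] at h
    let _ : Algebra (adjoin K b) F⟮u⟯ := (inclusion hle).toRingHom.toAlgebra
    have : IsScalarTower (adjoin K b) F⟮u⟯ L := IsScalarTower.of_algebraMap_eq fun _ => rfl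
    exact Algebra.IsAlgebraic.tower_top (K := adjoin K b) F⟮u⟯
  have : Algebra.EssFiniteType F L := Algebra.EssFiniteType.of_comp K F L
  have : Algebra.EssFiniteType F⟮u⟯ L := Algebra.EssFiniteType.of_comp F F⟮u⟯ L
  have : FiniteDimensional F⟮u⟯ L := Algebra.finite_of_essFiniteType_of_isAlgebraic
  exact ⟨Module.finrank F⟮u⟯ L, fun N w hw => huF.le_finrank_of_pow_eq hw⟩

/-! ### Étale neighborhoods modulo powers of the maximal ideal. -/

/-- A pointed étale neighborhood `B` of `A` agrees with `A` modulo every power of the maximal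
ideal. -/
theorem IsPointedEtaleNhd.bijective_quotient_pow {A B : Type*} [CommRing A] [IsLocalRing A]
    [CommRing B] [IsLocalRing B] [Algebra A B] (hB : IsPointedEtaleNhd A B) (n : ℕ) :
    Function.Bijective (algebraMap (A ⧸ maximalIdeal A ^ n)
      (B ⧸ (maximalIdeal A ^ n).map (algebraMap A B))) := by
  have := hB.isLocalHom
  have := hB.flat
  have : Module.FaithfullyFlat A B := Module.FaithfullyFlat.of_flat_of_isLocalHom
  constructor
  · rw [injective_iff_map_eq_zero]
    intro x hx
    obtain ⟨a, rfl⟩ := Ideal.Quotient.mk_surjective x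
    have h : algebraMap A B a ∈ (maximalIdeal A ^ n).map (algebraMap A B) :=
      Ideal.Quotient.eq_zero_iff_mem.mp hx
    rw [Ideal.Quotient.eq_zero_iff_mem,
      ← Ideal.comap_map_eq_self_of_faithfullyFlat (B := B) (maximalIdeal A ^ n)]
    exact h
  · have hstep : ∀ b : B, ∃ a : A, b - algebraMap A B a ∈ maximalIdeal B := by
      intro b
      obtain ⟨x, hx⟩ := hB.bijective_residueField.surjective (residue B b)
      obtain ⟨a, rfl⟩ := residue_surjective x
      refine ⟨a, ?_⟩
      rw [← residue_eq_zero_iff, map_sub, ← hx, sub_eq_zero]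
      rfl
    have key : ∀ b : B, ∃ a : A,
        b - algebraMap A B a ∈ (maximalIdeal A ^ n).map (algebraMap A B) := by
      induction n with
      | zero => intro b; exact ⟨0, by simp [Ideal.map_top]⟩
      | succ n ih =>
        intro b
        obtain ⟨a, ha⟩ := ih b
        -- The error is a `B`-combination of elements of `𝔪 ^ n`. Replacing its coefficients by
        -- elements of `A` with the same residue costs only terms in `𝔪 ^ n 𝔪_B = 𝔪 ^ (n + 1) B`.
        have hc : ∀ c ∈ (maximalIdeal A ^ n).map (algebraMap A B), ∃ a ∈ maximalIdeal A ^ n,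
            c - algebraMap A B a ∈ (maximalIdeal A ^ (n + 1)).map (algebraMap A B) := by
          intro c hc
          refine Submodule.span_induction (p := fun c _ => ∃ a ∈ maximalIdeal A ^ n,
            c - algebraMap A B a ∈ (maximalIdeal A ^ (n + 1)).map (algebraMap A B))
            ?_ ⟨0, by simp⟩ ?_ ?_ hc
          · rintro _ ⟨a, ha, rfl⟩
            exact ⟨a, ha, by simp⟩
          · rintro x y - - ⟨a, ha, hxa⟩ ⟨a', ha', hya⟩
            refine ⟨a + a', add_mem ha ha', ?_⟩
            rw [map_add, add_sub_add_comm]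
            exact add_mem hxa hya
          · rintro x y - ⟨a, ha, hya⟩
            obtain ⟨a₀, ha₀⟩ := hstep x
            refine ⟨a₀ * a, Ideal.mul_mem_left _ _ ha, ?_⟩
            have h : x • y - algebraMap A B (a₀ * a) =
                x * (y - algebraMap A B a) + algebraMap A B a * (x - algebraMap A B a₀) := by
              rw [smul_eq_mul, map_mul]; ring
            rw [h]
            refine add_mem (Ideal.mul_mem_left _ _ hya) ?_
            rw [pow_succ, Ideal.map_mul, hB.map_maximalIdeal]
            exact Ideal.mul_mem_mul (Ideal.mem_map_of_mem _ ha) ha₀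
        obtain ⟨a', -, ha'⟩ := hc _ ha
        exact ⟨a + a', by rwa [map_add, ← sub_sub]⟩
    intro y
    obtain ⟨b, rfl⟩ := Ideal.Quotient.mk_surjective y
    obtain ⟨a, ha⟩ := key b
    exact ⟨Ideal.Quotient.mk _ a, (Ideal.Quotient.eq.mpr ha).symm⟩

/-- The `A`-algebra homomorphism from a pointed étale neighborhood of `A` to `A ⧸ 𝔪 ^ n`. -/
noncomputable def IsPointedEtaleNhd.toQuotientPow {A B : Type*} [CommRing A] [IsLocalRing A]
    [CommRing B] [IsLocalRing B] [Algebra A B] (hB : IsPointedEtaleNhd A B) (n : ℕ) :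
    B →ₐ[A] A ⧸ maximalIdeal A ^ n :=
  ((AlgEquiv.ofBijective (Algebra.ofId (A ⧸ maximalIdeal A ^ n) _)
    (hB.bijective_quotient_pow n)).symm.toAlgHom.restrictScalars A).comp
    (Ideal.Quotient.mkₐ A _)

/-- Such a map kills `𝔪 ^ n B`, and `B = A + 𝔪 ^ n B`. This uniqueness makes the maps to `A ⧸ 𝔪 ^ n`
a cocone. -/
theorem IsPointedEtaleNhd.algHom_quotientPow_ext {A B : Type*} [CommRing A] [IsLocalRing A]
    [CommRing B] [IsLocalRing B] [Algebra A B] (hB : IsPointedEtaleNhd A B) {n : ℕ}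
    (f g : B →ₐ[A] A ⧸ maximalIdeal A ^ n) : f = g := by
  ext b
  obtain ⟨x, hx⟩ := (hB.bijective_quotient_pow n).surjective (Ideal.Quotient.mk _ b)
  obtain ⟨a, rfl⟩ := Ideal.Quotient.mk_surjective x
  have hmem : algebraMap A B a - b ∈ (maximalIdeal A ^ n).map (algebraMap A B) :=
    Ideal.Quotient.eq.mp hx
  have key : ∀ h : B →ₐ[A] A ⧸ maximalIdeal A ^ n, h b = Ideal.Quotient.mk _ a := by
    intro h
    have hle : (maximalIdeal A ^ n).map (algebraMap A B) ≤ RingHom.ker h := by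
      rw [Ideal.map_le_iff_le_comap]
      intro x hx
      rw [Ideal.mem_comap, RingHom.mem_ker, h.commutes]
      exact Ideal.Quotient.eq_zero_iff_mem.mpr hx
    have h0 := hle hmem
    rw [RingHom.mem_ker, map_sub, h.commutes, sub_eq_zero] at h0
    exact h0.symm
  rw [key f, key g]

/-! ### Maps out of the henselization. -/

namespace PointedEtaleNhd

open CategoryTheory Limits

/-- The compatible system of homomorphisms from the pointed étale neighborhoods of `A` to
`A ⧸ 𝔪 ^ n`. -/
noncomputable def coconeQuotientPow (A : Type u) [CommRing A] [IsLocalRing A] (n : ℕ) :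
    Cocone (diagram A) where
  pt := CommAlgCat.of A (A ⧸ maximalIdeal A ^ n)
  ι :=
    { app := fun B => CommAlgCat.ofHom (B.isPointedEtaleNhd.toQuotientPow n)
      naturality := fun B _ _ =>
        CommAlgCat.hom_ext (B.isPointedEtaleNhd.algHom_quotientPow_ext _ _) }

end PointedEtaleNhd

namespace Henselization

open CategoryTheory Limits

/-- The canonical map from the henselization of `A` to `A ⧸ 𝔪 ^ n`. -/
noncomputable def toQuotientPow (A : Type u) [CommRing A] [IsLocalRing A] (n : ℕ) :
    Henselization A →ₐ[A] A ⧸ maximalIdeal A ^ n :=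
  (colimit.desc _ (PointedEtaleNhd.coconeQuotientPow A n)).hom

/-- The canonical map from a pointed étale neighborhood of `A` to the henselization of `A`. -/
noncomputable def ofNhd {A : Type u} [CommRing A] [IsLocalRing A] (B : PointedEtaleNhd A) :
    Localization.AtPrime B.q.asIdeal →ₐ[A] Henselization A :=
  (colimit.ι (PointedEtaleNhd.diagram A) B).hom

/-- The maps to all `A ⧸ 𝔪 ^ n` put the kernel inside `⋂ 𝔪 ^ n`, which is zero by Krull's
intersection theorem. -/
theorem algebraMap_injective (A : Type u) [CommRing A] [IsLocalRing A] [IsNoetherianRing A] :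
    Function.Injective (algebraMap A (Henselization A)) := by
  rw [injective_iff_map_eq_zero]
  intro a ha
  have h : a ∈ ⨅ n : ℕ, maximalIdeal A ^ n := by
    rw [Ideal.mem_iInf]
    intro n
    have h := (toQuotientPow A n).commutes a
    rw [ha, map_zero] at h
    exact Ideal.Quotient.eq_zero_iff_mem.mp h.symm
  rwa [Ideal.iInf_pow_eq_bot_of_isLocalRing _ (maximalIdeal.isMaximal A).ne_top] at h

end Henselization

/-! ### Adjoining an `N`-th root of `1 + t`. -/

namespace IsLocalRing

variable {A : Type u} [CommRing A] [IsLocalRing A]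

open Polynomial in
/-- If `t` lies in the maximal ideal of `A` and `N` is a unit in `A`, then `1 + t` has an `N`-th
root in a pointed étale neighborhood of `A`. -/
theorem exists_isPointedEtaleNhd_pow_eq {t : A} (ht : t ∈ maximalIdeal A) {N : ℕ}
    (hN : IsUnit (N : A)) :
    ∃ (B : Type u) (_ : CommRing B) (_ : IsLocalRing B) (_ : Algebra A B) (w : B),
      IsPointedEtaleNhd A B ∧ w ^ N = algebraMap A B (1 + t) := by
  have hN0 : N ≠ 0 := by
    rintro rfl
    simp at hN
  let f : A[X] := X ^ N - C (1 + t)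
  have hf : f.Monic := monic_X_pow_sub_C _ hN0
  let R := AdjoinRoot f
  let x : R := AdjoinRoot.root f
  have hx : x ^ N = algebraMap A R (1 + t) := by
    have h : f.aeval x = 0 := by
      rw [AdjoinRoot.aeval_eq, AdjoinRoot.mk_self]
    simpa [f, sub_eq_zero] using h
  have : Module.Free A R := hf.free_adjoinRoot
  have : Module.Finite A R := hf.finite_adjoinRoot
  have hres : residue A t = 0 := (residue_eq_zero_iff t).mpr ht
  -- Modulo `𝔪` the polynomial is `X ^ N - 1`; its root `1` gives a rational point of the closed
  -- fibre, at which `R` is localized.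
  let φ : R →ₐ[A] ResidueField A := AdjoinRoot.liftAlgHom f (Algebra.ofId A _) 1 (by
    change f.eval₂ (residue A) 1 = 0
    simp [f, hres])
  have hφx : φ x = 1 := AdjoinRoot.liftAlgHom_root _ _ _ _
  have hφsurj : Function.Surjective φ := fun y => by
    obtain ⟨a, rfl⟩ := residue_surjective y
    exact ⟨algebraMap A R a, φ.commutes a⟩
  let q : Ideal R := RingHom.ker φ
  have hq : q.IsMaximal := RingHom.ker_isMaximal_of_surjective φ hφsurj
  let B := Localization.AtPrime q
  have hqa : ∀ a : A, algebraMap A R a ∈ q ↔ a ∈ maximalIdeal A := fun a => by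
    rw [RingHom.mem_ker, φ.commutes, ← residue_eq_zero_iff]
    rfl
  have hx1q : x - 1 ∈ q := by
    rw [RingHom.mem_ker, map_sub, map_one, sub_eq_zero]
    exact hφx
  have hunit : ∀ r : R, IsUnit (algebraMap R B r) ↔ r ∉ q := fun r =>
    IsLocalization.AtPrime.isUnit_to_map_iff B q r
  have hloc : IsLocalHom (algebraMap A B) := by
    refine ⟨fun a ha => ?_⟩
    rw [IsScalarTower.algebraMap_apply A R B, hunit, hqa] at ha
    exact notMem_maximalIdeal.mp ha
  have hrep : ∀ r : R, ∃ a : A, r - algebraMap A R a ∈ Ideal.span {x - 1} := by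
    intro r
    obtain ⟨p, rfl⟩ := AdjoinRoot.mk_surjective r
    refine ⟨p.eval 1, Ideal.mem_span_singleton.mpr ?_⟩
    simpa [R, x, AdjoinRoot.mk_X, AdjoinRoot.mk_C, AdjoinRoot.algebraMap_eq] using
      map_dvd (AdjoinRoot.mk f) (X_sub_C_dvd_sub_C_eval (p := p) (a := 1))
  -- `(x - 1)(1 + x + ⋯ + x ^ (N - 1)) = t`, and the second factor has residue `N ≠ 0`, so it is a
  -- unit in `B`. With `R = A + (x - 1)` this gives `𝔪 B = 𝔪_B`.
  have hx1 : algebraMap R B (x - 1) ∈ (maximalIdeal A).map (algebraMap A B) := by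
    have hg : IsUnit (algebraMap R B (∑ i ∈ Finset.range N, x ^ i)) := by
      rw [hunit, RingHom.mem_ker]
      simpa [hφx] using (hN.map (residue A)).ne_zero
    rw [← Ideal.mul_unit_mem_iff_mem _ hg, ← map_mul, mul_geom_sum, hx, map_add, map_one,
      add_sub_cancel_left, ← IsScalarTower.algebraMap_apply]
    exact Ideal.mem_map_of_mem _ ht
  have hmap : (maximalIdeal A).map (algebraMap A B) = maximalIdeal B := by
    refine le_antisymm (((local_hom_TFAE (algebraMap A B)).out 0 2).mp hloc) ?_
    rw [← Localization.AtPrime.map_eq_maximalIdeal, Ideal.map_le_iff_le_comap]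
    intro r hr
    obtain ⟨a, ha⟩ := hrep r
    obtain ⟨c, hc⟩ := Ideal.mem_span_singleton.mp ha
    have hr' : r = algebraMap A R a + (x - 1) * c := by rw [← hc]; ring
    have ha' : a ∈ maximalIdeal A := by
      rw [← hqa]
      rw [hr'] at hr
      exact (Ideal.add_mem_iff_left _ (Ideal.mul_mem_right _ _ hx1q)).mp hr
    rw [Ideal.mem_comap, hr', map_add, map_mul, ← IsScalarTower.algebraMap_apply]
    exact add_mem (Ideal.mem_map_of_mem _ ha') (Ideal.mul_mem_right _ _ hx1)
  have hbij : Function.Bijective (algebraMap (ResidueField A) (ResidueField B)) := by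
    refine ⟨RingHom.injective _, fun y => ?_⟩
    obtain ⟨r, rfl⟩ := q.algebraMap_residueField_surjective y
    obtain ⟨a, ha⟩ := hrep r
    refine ⟨residue A a, ?_⟩
    change residue B (algebraMap A B a) = residue B (algebraMap R B r)
    rw [IsScalarTower.algebraMap_apply A R B, eq_comm, ← sub_eq_zero, ← map_sub, ← map_sub,
      residue_eq_zero_iff, ← Localization.AtPrime.map_eq_maximalIdeal]
    exact Ideal.mem_map_of_mem _ ((Ideal.span_singleton_le_iff_mem _).mpr hx1q ha)
  refine ⟨B, inferInstance, inferInstance, inferInstance, algebraMap R B x, ?_, ?_⟩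
  · exact
      { isLocalHom := hloc
        essFiniteType := Algebra.EssFiniteType.comp A R B
        map_maximalIdeal := hmap
        finite_residueField := Module.Finite.of_surjective
          (Algebra.linearMap (ResidueField A) (ResidueField B)) hbij.surjective
        isSeparable_residueField := by
          refine ⟨fun y => ?_⟩
          obtain ⟨z, rfl⟩ := hbij.surjective y
          exact isSeparable_algebraMap z
        flat := Module.Flat.trans A R B
        bijective_residueField := hbij }
  · rw [← map_pow, hx, ← IsScalarTower.algebraMap_apply]

end IsLocalRing

/-! ### Transcendental elements in local rings and in algebras essentially of finite type. -/

/-- In a local `K`-algebra, an element of the maximal ideal that is algebraic over `K` is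
nilpotent. -/
theorem IsAlgebraic.isNilpotent_of_mem_maximalIdeal {K A : Type*} [Field K] [CommRing A]
    [IsLocalRing A] [Algebra K A] {t : A} (h : IsAlgebraic K t) (ht : t ∈ maximalIdeal A) :
    IsNilpotent t := by
  obtain ⟨p, hp0, hp⟩ := h
  obtain ⟨g, hg, hg0⟩ := p.exists_eq_pow_rootMultiplicity_mul_and_not_dvd hp0 0
  rw [Polynomial.C_0, sub_zero] at hg hg0
  rw [Polynomial.X_dvd_iff] at hg0
  -- Here `p = X ^ k * g` with `g(0) ≠ 0`, and `g(t) ≡ g(0)` modulo the maximal ideal; so `p(t) = 0`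
  -- forces `t ^ k = 0`.
  have hunit : IsUnit (Polynomial.aeval t g) := by
    obtain ⟨r, hr⟩ := Polynomial.X_dvd_sub_C (p := g)
    have h1 : Polynomial.aeval t g - algebraMap K A (g.coeff 0) ∈ maximalIdeal A := by
      have := congrArg (Polynomial.aeval t) hr
      rw [map_sub, map_mul, Polynomial.aeval_C, Polynomial.aeval_X] at this
      rw [this]
      exact Ideal.mul_mem_right _ _ ht
    rw [← notMem_maximalIdeal]
    intro h2
    have h3 := sub_mem h2 h1
    rw [sub_sub_cancel] at h3
    exact notMem_maximalIdeal.mpr ((IsUnit.mk0 _ hg0).map (algebraMap K A)) h3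
  refine ⟨p.rootMultiplicity 0, ?_⟩
  rw [hg, map_mul, map_pow, Polynomial.aeval_X] at hp
  exact hunit.mul_left_eq_zero.mp hp

/-- A local `K`-algebra of positive Krull dimension has an element of the maximal ideal that is
transcendental over `K`. -/
theorem IsLocalRing.exists_mem_maximalIdeal_transcendental (K : Type*) {A : Type*} [Field K]
    [CommRing A] [IsLocalRing A] [Algebra K A] (hdim : 1 ≤ ringKrullDim A) :
    ∃ t ∈ maximalIdeal A, Transcendental K t := by
  by_contra! h
  have hnil : ∀ t ∈ maximalIdeal A, IsNilpotent t := fun t ht =>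
    (not_not.mp (h t ht)).isNilpotent_of_mem_maximalIdeal ht
  have : Ring.KrullDimLE 0 A := by
    rw [Ring.krullDimLE_zero_iff]
    intro I hI
    have h : maximalIdeal A = I := le_antisymm (fun t ht => by
      obtain ⟨n, hn⟩ := hnil t ht
      exact hI.mem_of_pow_mem n (hn ▸ I.zero_mem)) (le_maximalIdeal hI.ne_top)
    exact h ▸ maximalIdeal.isMaximal A
  have h0 := Ring.krullDimLE_iff.mp this
  exact absurd (hdim.trans h0) (by decide)

/-- An element transcendental over `K` remains transcendental modulo some prime ideal. -/
theorem Transcendental.exists_isPrime_quotient {K R : Type*} [Field K] [CommRing R] [Algebra K R]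
    {x : R} (hx : Transcendental K x) :
    ∃ (P : Ideal R) (_ : P.IsPrime), Transcendental K (Ideal.Quotient.mk P x) := by
  -- Transcendence says that the values at `x` of nonzero polynomials form a multiplicative set
  -- avoiding `0`; a prime disjoint from it preserves transcendence.
  let S : Submonoid R := (nonZeroDivisors (Polynomial K)).map (Polynomial.aeval (R := K) x)
  have hS : Disjoint ((⊥ : Ideal R) : Set R) (S : Set R) := by
    rw [Set.disjoint_left]
    rintro _ h0 ⟨p, hp, rfl⟩
    exact nonZeroDivisors.ne_zero hp (transcendental_iff.mp hx p h0)
  obtain ⟨P, hP, -, hPS⟩ := Ideal.exists_le_prime_disjoint ⊥ S hS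
  refine ⟨P, hP, ?_⟩
  rw [transcendental_iff]
  intro p hp
  by_contra hp0
  have hmem : Polynomial.aeval x p ∉ P := fun h =>
    Set.disjoint_left.mp hPS h ⟨p, mem_nonZeroDivisors_of_ne_zero hp0, rfl⟩
  refine hmem ?_
  rw [← Ideal.Quotient.eq_zero_iff_mem, ← hp]
  exact (Polynomial.aeval_algHom_apply (Ideal.Quotient.mkₐ K P) x p).symm

/-- In an algebra essentially of finite type over a field `K`, an element transcendental over `K`
has `N`-th roots only for bounded `N`. -/
theorem Transcendental.exists_forall_pow_eq_le_of_essFiniteType {K R : Type*} [Field K]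
    [CommRing R] [Algebra K R] [Algebra.EssFiniteType K R] {x : R} (hx : Transcendental K x) :
    ∃ M : ℕ, ∀ (N : ℕ) (w : R), w ^ N = x → N ≤ M := by
  obtain ⟨P, hP, hxP⟩ := hx.exists_isPrime_quotient
  let L := FractionRing (R ⧸ P)
  have : Algebra.EssFiniteType (R ⧸ P) L :=
    Algebra.EssFiniteType.of_isLocalization L (nonZeroDivisors (R ⧸ P))
  have : Algebra.EssFiniteType K L := Algebra.EssFiniteType.comp K (R ⧸ P) L
  have hxL : Transcendental K (algebraMap (R ⧸ P) L (Ideal.Quotient.mk P x)) :=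
    (transcendental_algebraMap_iff (IsFractionRing.injective (R ⧸ P) L)).mpr hxP
  obtain ⟨M, hM⟩ := hxL.exists_forall_pow_eq_le
  exact ⟨M, fun N w hw => hM N (algebraMap (R ⧸ P) L (Ideal.Quotient.mk P w)) (by
    rw [← map_pow, ← map_pow, hw])⟩

/-! ### Conclusion. -/

/-- In a local ring, arbitrarily large natural numbers are units. -/
theorem IsLocalRing.exists_lt_isUnit_natCast (A : Type*) [CommRing A] [IsLocalRing A] (M : ℕ) :
    ∃ N : ℕ, M < N ∧ IsUnit (N : A) := by
  -- Two consecutive integers cannot both lie in the maximal ideal, whatever the residue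
  -- characteristic.
  have h : IsUnit ((M + 1 : ℕ) : A) ∨ IsUnit ((M + 2 : ℕ) : A) := by
    by_contra! h
    have h1 := sub_mem ((mem_maximalIdeal _).mpr h.2) ((mem_maximalIdeal _).mpr h.1)
    refine (maximalIdeal.isMaximal A).ne_top ((Ideal.eq_top_iff_one _).mpr ?_)
    convert h1 using 1
    push_cast
    ring
  rcases h with h | h
  · exact ⟨_, by lia, h⟩
  · exact ⟨_, by lia, h⟩

/-- If `t` lies in the maximal ideal of `A` and `N` is a unit in `A`, then `1 + t` has an `N`-th
root in the henselization of `A`. -/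
theorem Henselization.exists_pow_eq {A : Type u} [CommRing A] [IsLocalRing A] {t : A}
    (ht : t ∈ maximalIdeal A) {N : ℕ} (hN : IsUnit (N : A)) :
    ∃ w : Henselization A, w ^ N = algebraMap A (Henselization A) (1 + t) := by
  obtain ⟨B, _, _, _, w, hB, hw⟩ := exists_isPointedEtaleNhd_pow_eq ht hN
  obtain ⟨C, ⟨e⟩⟩ := PointedEtaleNhd.exists_algEquiv hB
  refine ⟨ofNhd C (e.symm w), ?_⟩
  rw [← map_pow, ← map_pow, hw, e.symm.commutes, (ofNhd C).commutes]

theorem mainTheorem6 {K : Type*} [Field K] {A : Type*} [CommRing A] [IsLocalRing A] [Algebra K A]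
    (hCM : IsCohenMacaulayLocalRing A)
    (hdim : 1 ≤ ringKrullDim A)
    (hess : Algebra.EssFiniteType K A)
    (hdom : IsDomain (AdicCompletion (maximalIdeal A) A)) :
    ¬ ((algebraMap A (Henselization A)).comp (algebraMap K A)).EssFiniteType := by
  intro h
  have := hCM.isNoetherianRing
  let _ : Algebra K (Henselization A) :=
    ((algebraMap A (Henselization A)).comp (algebraMap K A)).toAlgebra
  have : IsScalarTower K A (Henselization A) := IsScalarTower.of_algebraMap_eq fun _ => rfl
  have : Algebra.EssFiniteType K (Henselization A) := h
  obtain ⟨t, ht, htr⟩ := exists_mem_maximalIdeal_transcendental K hdim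
  have hu : Transcendental K (1 + t) := fun hu => htr <| by
    simpa using hu.sub (isAlgebraic_one (R := K) (A := A))
  have hu' : Transcendental K (algebraMap A (Henselization A) (1 + t)) :=
    (transcendental_algebraMap_iff (Henselization.algebraMap_injective A)).mpr hu
  obtain ⟨M, hM⟩ := hu'.exists_forall_pow_eq_le_of_essFiniteType
  obtain ⟨N, hMN, hN⟩ := exists_lt_isUnit_natCast A M
  obtain ⟨w, hw⟩ := Henselization.exists_pow_eq ht hN
  exact absurd (hM N w hw) hMN.not_ge
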